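/- A variety $\mathbf V$ of algebras is given by a set $\Omega_{\mathbf V}$ of operation symbols, an arity $\mathrm{ari}(\alpha)$ (a possibly infinite cardinal) for each $\alpha\in\Omega_{\mathbf V}$, and a set of identities between terms. Let $\mathbf C$ and $\mathbf D$ be varieties. For an object $A$ of $\mathbf C$ and a cardinal $\kappa$ let $\coprod_\kappa A$ be the $\kappa$-fold copower of $A$ in $\mathbf C$. A $\mathbf D$-coalgebra object $R$ of $\mathbf C$ is an algebra $|R|$ in $\mathbf C$ with a homomorphism (co-operation) $\alpha^R:|R|\to\coprod_{\mathrm{ari}(\alpha)}|R|$ for each $\alpha\in\Omega_{\mathbf D}$, which cosatisfies the identities of $\mathbf D$: for each identity $s=t$ of $\mathbf D$ in $\kappa$ variables, the $\kappa$-tuple of coprojections $|R|\to\coprod_\kappa|R|$ satisfies $s=t$ under the operations that the $\alpha^R$ induce on $\mathrm{Hom}_{\mathbf C}(|R|,\coprod_\kappa|R|)$. Morphisms of $\mathbf D$-coalgebras are homomorphisms of the underlying $\mathbf C$-algebras that commute with the co-operations; the cardinality of a coalgebra is that of its underlying set. Corollary. (a) Suppose that $\mathbf C$ and $\mathbf D$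 each have at most countably many operations, that all operations of $\mathbf C$ are finitary, and that every operation of $\mathbf D$ has arity less than $2^{\aleph_0}$. Then the category of $\mathbf D$-coalgebra objects of $\mathbf C$ has a final object, and its cardinality is at most $2^{\aleph_0}$. More generally, let $\mathbf E$ be a small category with at most countably many objects and let $F$ be a functor from $\mathbf E$ to the category of $\mathbf D$-coalgebra objects of $\mathbf C$ such that every $F(E)$ has cardinality at most $2^{\aleph_0}$. Then $F$ has a limit in that category, and this limit has cardinality at most $2^{\aleph_0}$. (b) The bound is attained. Let $\mathbf C=\mathbf{Set}$ (no operations, no identities) and let $\mathbf D$ be the variety of sets with one binary operation and no identities. Then the final $\mathbf D$-coalgebra object of $\mathbf C$ exists and has cardinality exactly $2^{\aleph_0}$; up to isomorphism it is the Cantor set $\{0,1\}^{\mathbb N}$ with the co-operation sending $(a_0,a_1,a_2,\dots)$ to the element $(a_1,a_2,\dots)$ of the $a_0$-th of the two copies of $\{0,1\}^{\mathbb N}$ in $\{0,1\}^{\mathbb N}\sqcup\{0,1\}^{\mathbb N}$. -/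

import Mathlib

open CategoryTheory CategoryTheory.Limits
open scoped Cardinal

universe u v w

namespace UnivAlg

/-- A type of algebras: a small set of operation symbols, each with a possibly infinite arity.
The arity of a symbol is given by an index type; its cardinality is the cardinal arity. -/
structure Signature : Type (u + 1) where
  Op : Type u
  arity : Op → Type u

/-- A family of operations on `X` indexed by the symbols of a signature. -/
abbrev Signature.OpStr (S : Signature.{u}) (X : Type v) : Type (max u v) :=
  ∀ α : S.Op, (S.arity α → X) → X

/-- Terms in variables from `X`: the underlying set of the term algebra on `X`. -/
inductive Signature.Term (S : Signature.{u}) (X : Type u) : Type u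
  | var : X → S.Term X
  | app : (α : S.Op) → (S.arity α → S.Term X) → S.Term X

/-- The value `s(x)` of a term at a tuple of elements of an algebra. -/
def Signature.Term.eval {S : Signature.{u}} {X : Type u} {A : Type v} (o : S.OpStr A)
    (x : X → A) : S.Term X → A
  | .var i => x i
  | .app α t => o α (fun j => (t j).eval o x)

/-- A variety of algebras: a signature together with a set of identities, each of them a pair
of terms in some small set of variables. -/
structure Variety : Type (u + 1) extends Signature.{u} where
  Idn : Type u
  vars : Idn → Type u
  lhs : ∀ φ : Idn, toSignature.Term (vars φ)
  rhs : ∀ φ : Idn, toSignature.Term (vars φ)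

/-- The operations satisfy all the identities of the variety. -/
def Variety.Satisfies (V : Variety.{u}) {A : Type v} (o : V.OpStr A) : Prop :=
  ∀ (φ : V.Idn) (x : V.vars φ → A), (V.lhs φ).eval o x = (V.rhs φ).eval o x

/-- An algebra in the variety `V`. -/
structure Variety.Alg (V : Variety.{u}) : Type (u + 1) where
  carrier : Type u
  op : V.OpStr carrier
  satisfies : V.Satisfies op

namespace Variety.Alg

variable {V : Variety.{u}}

/-- A homomorphism of algebras. -/
@[ext]
structure Hom (A B : V.Alg) : Type u where
  toFun : A.carrier → B.carrier
  map_op : ∀ (α : V.Op) (x : V.arity α → A.carrier),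
    toFun (A.op α x) = B.op α (fun i => toFun (x i))

instance : Category.{u} V.Alg where
  Hom := Hom
  id A := ⟨fun a => a, fun _ _ => rfl⟩
  comp f g := ⟨fun a => g.toFun (f.toFun a), fun α x => by rw [f.map_op, g.map_op]⟩

@[simp]
theorem comp_toFun {A B D : V.Alg} (f : A ⟶ B) (g : B ⟶ D) (a : A.carrier) :
    (f ≫ g).toFun a = g.toFun (f.toFun a) := rfl

@[simp]
theorem id_toFun (A : V.Alg) (a : A.carrier) : Hom.toFun (𝟙 A) a = a := rfl

theorem hom_ext {A B : V.Alg} {f g : A ⟶ B} (h : ∀ a, f.toFun a = g.toFun a) : f = g :=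
  Hom.ext (funext h)

/-! ### Coproducts of algebras, by generators and relations -/

section Coproduct

variable {I : Type u} (A : I → V.Alg)

/-- The least congruence on the term algebra on the disjoint union of the `A i` that makes the
quotient an algebra in `V` and the maps from the `A i` homomorphisms. -/
inductive CoprodRel : V.Term (Σ i, (A i).carrier) → V.Term (Σ i, (A i).carrier) → Prop
  | refl (s) : CoprodRel s s
  | symm {s t} : CoprodRel s t → CoprodRel t s
  | trans {s t r} : CoprodRel s t → CoprodRel t r → CoprodRel s r
  | app (α : V.Op) {s t : V.arity α → V.Term (Σ i, (A i).carrier)} :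
      (∀ j, CoprodRel (s j) (t j)) → CoprodRel (.app α s) (.app α t)
  | idn (φ : V.Idn) (σ : V.vars φ → V.Term (Σ i, (A i).carrier)) :
      CoprodRel ((V.lhs φ).eval Signature.Term.app σ) ((V.rhs φ).eval Signature.Term.app σ)
  | hom (i : I) (α : V.Op) (a : V.arity α → (A i).carrier) :
      CoprodRel (.var ⟨i, (A i).op α a⟩) (.app α (fun j => .var ⟨i, a j⟩))

/-- `CoprodRel` as a setoid. -/
def coprodSetoid : Setoid (V.Term (Σ i, (A i).carrier)) :=
  ⟨CoprodRel A, ⟨.refl, .symm, .trans⟩⟩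

/-- The operations on the quotient of the term algebra. -/
noncomputable def coprodOp : V.OpStr (Quotient (coprodSetoid A)) :=
  fun α x => Quotient.mk (coprodSetoid A) (.app α (fun j => (x j).out))

theorem coprodOp_mk (α : V.Op) (s : V.arity α → V.Term (Σ i, (A i).carrier)) :
    coprodOp A α (fun j => Quotient.mk (coprodSetoid A) (s j)) =
      Quotient.mk (coprodSetoid A) (.app α s) :=
  Quotient.sound (s := coprodSetoid A)
    (CoprodRel.app α fun j => Quotient.mk_out (s := coprodSetoid A) (s j))

theorem eval_coprodOp {X : Type u} (σ : X → V.Term (Σ i, (A i).carrier)) (s : V.Term X) :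
    s.eval (coprodOp A) (fun i => Quotient.mk (coprodSetoid A) (σ i)) =
      Quotient.mk (coprodSetoid A) (s.eval Signature.Term.app σ) := by
  induction s with
  | var i => rfl
  | app α t ih =>
    simp only [Signature.Term.eval, ih]
    exact coprodOp_mk A α _

/-- The coproduct of a family of algebras. -/
noncomputable def coprod : V.Alg where
  carrier := Quotient (coprodSetoid A)
  op := coprodOp A
  satisfies φ x := by
    have hx : x = fun i => Quotient.mk (coprodSetoid A) (x i).out :=
      funext fun i => (Quotient.out_eq (x i)).symm
    rw [hx, eval_coprodOp, eval_coprodOp]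
    exact Quotient.sound (s := coprodSetoid A) (.idn φ _)

/-- The coprojections. -/
noncomputable def coprodι (i : I) : A i ⟶ coprod A where
  toFun a := Quotient.mk (coprodSetoid A) (.var ⟨i, a⟩)
  map_op α a := (Quotient.sound (s := coprodSetoid A) (.hom i α a)).trans
    (coprodOp_mk A α _).symm

variable {A}

theorem eval_eval {B : Type u} (o : V.OpStr B) {X Y : Type u} (x : X → B)
    (σ : Y → V.Term X) (s : V.Term Y) :
    (s.eval Signature.Term.app σ).eval o x = s.eval o (fun i => (σ i).eval o x) := by
  induction s with
  | var i => rfl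
  | app α t ih => simp only [Signature.Term.eval, ih]

theorem coprodRel_eval {B : V.Alg} (f : ∀ i, A i ⟶ B) {s t : V.Term (Σ i, (A i).carrier)}
    (h : CoprodRel A s t) :
    s.eval B.op (fun p => (f p.1).toFun p.2) = t.eval B.op (fun p => (f p.1).toFun p.2) := by
  induction h with
  | refl s => rfl
  | symm _ ih => exact ih.symm
  | trans _ _ ih₁ ih₂ => exact ih₁.trans ih₂
  | app α _ ih => simp only [Signature.Term.eval, ih]
  | idn φ σ =>
    rw [eval_eval, eval_eval]
    exact B.satisfies φ _
  | hom i α a => exact (f i).map_op α a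

/-- The homomorphism out of the coproduct induced by a family of homomorphisms. -/
noncomputable def coprodDesc {B : V.Alg} (f : ∀ i, A i ⟶ B) : coprod A ⟶ B where
  toFun := Quotient.lift (s := coprodSetoid A)
    (fun s => s.eval B.op (fun p => (f p.1).toFun p.2)) (fun _ _ h => coprodRel_eval f h)
  map_op α x := by
    have hx : x = fun i => Quotient.mk (coprodSetoid A) (x i).out :=
      funext fun i => (Quotient.out_eq (x i)).symm
    rw [hx]
    exact congrArg _ (coprodOp_mk A α _)

theorem coprod_hom_ext {B : V.Alg} {g h : coprod A ⟶ B}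
    (H : ∀ i, coprodι A i ≫ g = coprodι A i ≫ h) : g = h := by
  apply hom_ext
  intro a
  induction a using Quotient.inductionOn with
  | h s =>
    induction s with
    | var p => exact congrFun (congrArg Hom.toFun (H p.1)) p.2
    | app α t ih =>
      rw [← coprodOp_mk]
      exact ((g.map_op α _).trans (congrArg _ (funext ih))).trans (h.map_op α _).symm

variable (A) in
/-- The universal property of the coproduct. -/
noncomputable def coprodIsColimit : IsColimit (Cofan.mk (coprod A) (coprodι A)) :=
  Cofan.IsColimit.mk _ (fun s => coprodDesc s.inj) (fun _ _ => rfl)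
    (fun _ _ hm => coprod_hom_ext hm)

end Coproduct

instance : HasCoproducts.{u} V.Alg := fun I =>
  have : ∀ A : I → V.Alg, HasCoproduct A := fun A => ⟨⟨⟨_, coprodIsColimit A⟩⟩⟩
  ⟨fun _ => hasColimit_of_iso Discrete.natIsoFunctor⟩

end Variety.Alg

/-! ### Coalgebras -/

section Coalgebra

variable (D : Variety.{u}) (𝒜 : Type w) [Category.{v} 𝒜] [HasCoproducts.{u} 𝒜]

/-- An object with a co-operation `|R| ⟶ ∐_{arity α} |R|` for every symbol `α`. -/
structure OpCoalg : Type (max u v w) where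
  obj : 𝒜
  coop : ∀ α : D.Op, obj ⟶ ∐ (fun _ : D.arity α => obj)

variable {D 𝒜}

/-- The operations that the co-operations induce on the hom-set `𝒜(|R|, A)`. -/
noncomputable def OpCoalg.homOp (R : OpCoalg D 𝒜) (A : 𝒜) : D.OpStr (R.obj ⟶ A) :=
  fun α f => R.coop α ≫ Sigma.desc f

/-- `R` cosatisfies the identities of `D`: for each identity `s = t` in variables `κ`, the tuple
of coprojections `|R| ⟶ ∐_κ |R|` satisfies `s = t` in the algebra `𝒜(R, ∐_κ |R|)`. -/
def OpCoalg.Cosatisfies (R : OpCoalg D 𝒜) : Prop :=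
  ∀ φ : D.Idn,
    (D.lhs φ).eval (R.homOp (∐ fun _ : D.vars φ => R.obj)) (Sigma.ι fun _ => R.obj) =
      (D.rhs φ).eval (R.homOp (∐ fun _ : D.vars φ => R.obj)) (Sigma.ι fun _ => R.obj)

variable (D 𝒜)

/-- A `D`-coalgebra object of `𝒜`. -/
structure Coalg : Type (max u v w) extends OpCoalg D 𝒜 where
  cosatisfies : toOpCoalg.Cosatisfies

variable {D 𝒜}

/-- A morphism of coalgebras: a morphism of the underlying objects that makes commuting squares
with the co-operations. -/
@[ext]
structure Coalg.Hom (R S : Coalg D 𝒜) : Type v where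
  hom : R.obj ⟶ S.obj
  comm : ∀ α : D.Op, R.coop α ≫ Limits.Sigma.map (fun _ : D.arity α => hom) = hom ≫ S.coop α

noncomputable instance : Category.{v} (Coalg D 𝒜) where
  Hom := Coalg.Hom
  id R := ⟨𝟙 R.obj, fun α => by simp⟩
  comp f g := ⟨f.hom ≫ g.hom, fun α => by
    rw [Category.assoc, ← g.comm, ← Category.assoc, ← f.comm, Category.assoc, Sigma.map_comp_map]⟩

end Coalgebra

/-- The underlying set of (the underlying algebra of) a `D`-coalgebra object of the variety `C`. -/
abbrev Coalg.Carrier {C D : Variety.{u}} (R : Coalg D C.Alg) : Type u := R.obj.carrier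

/-- The variety of sets: no operations and no identities. -/
def setVariety : Variety.{u} where
  Op := PEmpty
  arity := PEmpty.elim
  Idn := PEmpty
  vars := PEmpty.elim
  lhs φ := φ.elim
  rhs φ := φ.elim

/-- The variety of sets with one binary operation and no identities. -/
def binVariety : Variety.{u} where
  Op := PUnit
  arity _ := ULift Bool
  Idn := PEmpty
  vars := PEmpty.elim
  lhs φ := φ.elim
  rhs φ := φ.elim

end UnivAlg

open UnivAlg

/-! A limit of `F` is a terminal object of the category of cones over `F`, and a final coalgebra is
the limit of the empty diagram. Terminal cones are built from countable pieces. Call a homomorphism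
pure if it stays injective on all copowers; co-operations and coalgebra morphisms then restrict
along it. By a Löwenheim–Skolem argument (`Coalg.exists_countable_isPure`), any countable subset of
a coalgebra lies in a countable pure subcoalgebra, because a relation in a copower is derived from
countably many elements.

Countable coalgebras live, up to isomorphism, on subsets of ℕ, so cones with such vertices form a
small family. Colimits of coalgebras are computed on underlying algebras; let T be the colimit of
this family. Any cone is covered by its countable pure subcones, so the coprojections glue to a
unique morphism to T (`ConeCode.exists_glue`, `nonempty_isTerminal_of_dense`).

For the bound, each element of a coalgebra is the image of an element of a coded one. There are at
most 𝔠 codes, each with countably many elements, so it suffices that each code has at most 𝔠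
morphisms into the limit.

In sets, a binary coalgebra is a map x ↦ (bit, next state); the stream of bits is the unique
morphism to the Cantor set. -/

namespace UnivAlg

/-! ### Terms -/

namespace Signature.Term

variable {S : Signature.{u}} {X Y Z : Type u}

/-- Substitution of variables for variables. -/
def map (f : X → Y) : S.Term X → S.Term Y
  | .var i => .var (f i)
  | .app α t => .app α (fun j => (t j).map f)

theorem map_map (f : X → Y) (g : Y → Z) (s : S.Term X) :
    (s.map f).map g = s.map (fun i => g (f i)) := by
  induction s with
  | var i => rfl
  | app α t ih => simp only [map, ih]

theorem map_id (s : S.Term X) : s.map (fun i => i) = s := by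
  induction s with
  | var i => rfl
  | app α t ih => simp only [map, ih]

theorem eval_map {A : Type v} (o : S.OpStr A) (f : X → Y) (x : Y → A) (s : S.Term X) :
    (s.map f).eval o x = s.eval o (fun i => x (f i)) := by
  induction s with
  | var i => rfl
  | app α t ih => simp only [map, eval, ih]

theorem map_eval_app (f : Y → Z) (σ : X → S.Term Y) (s : S.Term X) :
    (s.eval app σ).map f = s.eval app (fun i => (σ i).map f) := by
  induction s with
  | var i => rfl
  | app α t ih => simp only [map, eval, ih]

/-- A term in a finitary signature depends on finitely many variables only. -/
theorem exists_finite_support (hS : ∀ α : S.Op, Finite (S.arity α)) (s : S.Term X) :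
    ∃ F : Set X, F.Finite ∧ ∀ {Y : Type u} (f g : X → Y), (∀ i ∈ F, f i = g i) →
      s.map f = s.map g := by
  induction s with
  | var i => exact ⟨{i}, Set.finite_singleton i, fun f g h => by simp [map, h]⟩
  | app α t ih =>
    choose F hF h using ih
    have := hS α
    refine ⟨⋃ j, F j, Set.finite_iUnion hF, fun f g hfg => ?_⟩
    simp only [map]
    congr 1
    funext j
    exact h j f g fun i hi => hfg i (Set.mem_iUnion_of_mem j hi)

/-- Terms as elements of a `W`-type. -/
def toWType : S.Term X → WType (Sum.elim (fun _ : X => PEmpty.{u + 1}) S.arity)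
  | .var i => .mk (.inl i) PEmpty.elim
  | .app α t => .mk (.inr α) (fun j => (t j).toWType)

theorem toWType_injective : Function.Injective (toWType (S := S) (X := X)) := by
  intro s
  induction s with
  | var i =>
    intro t h
    cases t with
    | var j =>
      injection h with h _
      rw [Sum.inl.inj h]
    | app β t =>
      injection h with h _
      cases h
  | app α s ih =>
    intro t h
    cases t with
    | var j =>
      injection h with h _
      cases h
    | app β t =>
      injection h with h₁ h₂
      cases h₁
      congr 1
      funext j
      exact ih j (congrFun (eq_of_heq h₂) j)

theorem mk_le (hO : Countable S.Op) (hS : ∀ α : S.Op, Finite (S.arity α)) {κ : Cardinal.{u}}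
    (hκ : ℵ₀ ≤ κ) (hX : #X ≤ κ) : #(S.Term X) ≤ κ := by
  have : ∀ a, Finite (Sum.elim (fun _ : X => PEmpty.{u + 1}) S.arity a) := by
    rintro (i | α)
    · exact inferInstanceAs (Finite PEmpty)
    · exact hS α
  refine (Cardinal.mk_le_of_injective toWType_injective).trans
    ((WType.cardinalMk_le_max_aleph0_of_finite).trans (max_le ?_ hκ))
  rw [Cardinal.mk_sum, Cardinal.lift_id, Cardinal.lift_id]
  exact Cardinal.add_le_of_le hκ hX ((Cardinal.mk_le_aleph0_iff.2 hO).trans hκ)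

theorem countable (hO : Countable S.Op) (hS : ∀ α : S.Op, Finite (S.arity α)) [Countable X] :
    Countable (S.Term X) :=
  Cardinal.mk_le_aleph0_iff.1 (mk_le hO hS le_rfl (Cardinal.mk_le_aleph0_iff.2 ‹_›))

end Signature.Term

namespace Variety.Alg

variable {V : Variety.{u}}

theorem Hom.map_eval {A B : V.Alg} (f : A ⟶ B) {X : Type u} (x : X → A.carrier)
    (s : V.Term X) : f.toFun (s.eval A.op x) = s.eval B.op (fun i => f.toFun (x i)) := by
  induction s with
  | var i => rfl
  | app α t ih => simp only [Signature.Term.eval, ← ih]; exact f.map_op _ _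

/-- A homomorphism with values in the image of an injective homomorphism factors through it. -/
theorem exists_lift {A B M : V.Alg} (g : A ⟶ B) (m : M ⟶ B) (hm : Function.Injective m.toFun)
    (h : ∀ a, ∃ b, m.toFun b = g.toFun a) : ∃ l : A ⟶ M, l ≫ m = g := by
  choose l hl using h
  refine ⟨⟨l, fun α x => hm ?_⟩, hom_ext hl⟩
  rw [hl, g.map_op, m.map_op]
  simp only [hl]

theorem mono_of_injective {A B : V.Alg} (f : A ⟶ B) (hf : Function.Injective f.toFun) :
    Mono f :=
  ⟨fun _ _ e => hom_ext fun a => hf (congrFun (congrArg Hom.toFun e) a)⟩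

/-- The isomorphism with a given bijective homomorphism. -/
noncomputable def isoOfEquiv {A B : V.Alg} (f : A ⟶ B) (e : A.carrier ≃ B.carrier)
    (h : ∀ a, f.toFun a = e a) : A ≅ B where
  hom := f
  inv := ⟨e.symm, fun α x => by
    rw [Equiv.symm_apply_eq, ← h, f.map_op]
    simp [h]⟩
  hom_inv_id := hom_ext fun a => by simp [h]
  inv_hom_id := hom_ext fun a => by simp [h]

/-! ### Coproducts as terms modulo derivable relations. -/

section Coproduct

variable {I J : Type u}

/-- The index set may change along `g`; this is what later reduces purity to a countable index set.
-/
theorem CoprodRel.map {A : I → V.Alg} {B : J → V.Alg} (g : I → J) (f : ∀ i, A i ⟶ B (g i))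
    {s t : V.Term (Σ i, (A i).carrier)} (h : CoprodRel A s t) :
    CoprodRel B (s.map fun p => ⟨g p.1, (f p.1).toFun p.2⟩)
      (t.map fun p => ⟨g p.1, (f p.1).toFun p.2⟩) := by
  induction h with
  | refl s => exact .refl _
  | symm _ ih => exact .symm ih
  | trans _ _ ih₁ ih₂ => exact .trans ih₁ ih₂
  | app α _ ih => exact .app α ih
  | idn φ σ => rw [Signature.Term.map_eval_app, Signature.Term.map_eval_app]; exact .idn φ _
  | hom i α a =>
    simp only [Signature.Term.map, (f i).map_op]
    exact .hom (g i) α _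

/-- A relation in a copower involves countably many elements of the algebra only: it holds in the
copower of every retract (in the sense of sets) that contains these elements. -/
theorem CoprodRel.exists_countable (hV : ∀ α : V.Op, Finite (V.arity α)) {R : V.Alg}
    {s t : V.Term (Σ _ : I, R.carrier)} (h : CoprodRel (fun _ : I => R) s t) :
    ∃ W : Set R.carrier, W.Countable ∧ ∀ (Q : V.Alg) (f : Q ⟶ R) (ρ : R.carrier → Q.carrier),
      (∀ q, ρ (f.toFun q) = q) → (∀ r ∈ W, f.toFun (ρ r) = r) →
      CoprodRel (fun _ : I => Q) (s.map fun p => ⟨p.1, ρ p.2⟩) (t.map fun p => ⟨p.1, ρ p.2⟩) := by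
  induction h with
  | refl s => exact ⟨∅, Set.countable_empty, fun _ _ _ _ _ => .refl _⟩
  | symm _ ih =>
    obtain ⟨W, hW, h⟩ := ih
    exact ⟨W, hW, fun Q f ρ h₁ h₂ => .symm (h Q f ρ h₁ h₂)⟩
  | trans _ _ ih₁ ih₂ =>
    obtain ⟨W, hW, h⟩ := ih₁
    obtain ⟨W', hW', h'⟩ := ih₂
    exact ⟨W ∪ W', hW.union hW', fun Q f ρ h₁ h₂ => .trans
      (h Q f ρ h₁ fun r hr => h₂ r (.inl hr)) (h' Q f ρ h₁ fun r hr => h₂ r (.inr hr))⟩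
  | app α _ ih =>
    choose W hW h using ih
    have := hV α
    exact ⟨⋃ j, W j, Set.countable_iUnion hW, fun Q f ρ h₁ h₂ => .app α fun j =>
      h j Q f ρ h₁ fun r hr => h₂ r (Set.mem_iUnion_of_mem j hr)⟩
  | idn φ σ =>
    refine ⟨∅, Set.countable_empty, fun _ _ _ _ _ => ?_⟩
    rw [Signature.Term.map_eval_app, Signature.Term.map_eval_app]
    exact .idn φ _
  | hom i α a =>
    have := hV α
    refine ⟨Set.range a, Set.countable_range a, fun Q f ρ h₁ h₂ => ?_⟩
    -- `ρ` is only a map of sets. It respects this operation because `f` after `ρ` fixes the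
    -- arguments, so the value is the image of `Q.op α (ρ ∘ a)` under `f`, and `ρ` is a left inverse
    -- of `f`.
    have key : ρ (R.op α a) = Q.op α (fun j => ρ (a j)) := by
      rw [← h₁ (Q.op α _), f.map_op]
      simp only [h₂ _ (Set.mem_range_self _)]
    simp only [Signature.Term.map, key]
    exact .hom (A := fun _ : I => Q) i α _

variable (A : I → V.Alg)

/-- The concrete coproduct is isomorphic to the chosen one. -/
noncomputable def coprodIso : coprod A ≅ ∐ A :=
  (coprodIsColimit A).coconePointUniqueUpToIso (colimit.isColimit _)

theorem coprodι_coprodIso_hom (i : I) : coprodι A i ≫ (coprodIso A).hom = Limits.Sigma.ι A i :=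
  (coprodIsColimit A).comp_coconePointUniqueUpToIso_hom (colimit.isColimit _) ⟨i⟩

/-- The element of the coproduct with a given expression in terms of the `A i`. -/
noncomputable def sigmaMk (s : V.Term (Σ i, (A i).carrier)) : (∐ A).carrier :=
  s.eval (∐ A).op (fun p => (Limits.Sigma.ι A p.1).toFun p.2)

theorem sigmaMk_eq (s : V.Term (Σ i, (A i).carrier)) :
    sigmaMk A s = (coprodIso A).hom.toFun (Quotient.mk (coprodSetoid A) s) := by
  have h : Quotient.mk (coprodSetoid A) s =
      s.eval (coprod A).op (fun p => (coprodι A p.1).toFun p.2) := by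
    induction s with
    | var p => rfl
    | app α t ih =>
      rw [← coprodOp_mk]
      exact congrArg (coprodOp A α) (funext ih)
  rw [h, Hom.map_eval]
  simp only [← comp_toFun, coprodι_coprodIso_hom]
  rfl

theorem coprodIso_hom_injective : Function.Injective (coprodIso A).hom.toFun :=
  Function.LeftInverse.injective (g := (coprodIso A).inv.toFun) fun a =>
    congrFun (congrArg Hom.toFun (coprodIso A).hom_inv_id) a

theorem sigmaMk_surjective : Function.Surjective (sigmaMk A) := fun a => by
  obtain ⟨s, hs⟩ := Quotient.exists_rep (s := coprodSetoid A) ((coprodIso A).inv.toFun a)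
  refine ⟨s, (sigmaMk_eq A s).trans ((congrArg (coprodIso A).hom.toFun hs).trans ?_)⟩
  exact congrFun (congrArg Hom.toFun (coprodIso A).inv_hom_id) a

theorem sigmaMk_eq_iff {s t : V.Term (Σ i, (A i).carrier)} :
    sigmaMk A s = sigmaMk A t ↔ CoprodRel A s t := by
  rw [sigmaMk_eq, sigmaMk_eq]
  exact (coprodIso_hom_injective A).eq_iff.trans (Quotient.eq (r := coprodSetoid A))

theorem sigmaMap_sigmaMk {B : I → V.Alg} (f : ∀ i, A i ⟶ B i)
    (s : V.Term (Σ i, (A i).carrier)) :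
    (Limits.Sigma.map f).toFun (sigmaMk A s) =
      sigmaMk B (s.map fun p => ⟨p.1, (f p.1).toFun p.2⟩) := by
  rw [sigmaMk, sigmaMk, Hom.map_eval, Signature.Term.eval_map]
  simp only [← comp_toFun, Sigma.ι_map]

theorem mk_sigma_le (hO : Countable V.Op) (hV : ∀ α : V.Op, Finite (V.arity α))
    {κ : Cardinal.{u}} (hκ : ℵ₀ ≤ κ) (hA : #(Σ i, (A i).carrier) ≤ κ) :
    #(∐ A).carrier ≤ κ :=
  (Cardinal.mk_le_of_surjective (sigmaMk_surjective A)).trans (Signature.Term.mk_le hO hV hκ hA)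

end Coproduct

end Variety.Alg

/-! ### Colimits of algebras -/

namespace Variety.Alg

variable {V : Variety.{u}}

section Quotient

variable (A : V.Alg) (r : Setoid A.carrier)
  (hr : ∀ (α : V.Op) (x y : V.arity α → A.carrier), (∀ j, r.r (x j) (y j)) →
    r.r (A.op α x) (A.op α y))

/-- The operations on the quotient of an algebra by an equivalence relation. -/
noncomputable def quotientOp : V.OpStr (Quotient r) :=
  fun α x => Quotient.mk r (A.op α (fun j => (x j).out))

include hr in
theorem quotientOp_mk (α : V.Op) (x : V.arity α → A.carrier) :
    quotientOp A r α (fun j => Quotient.mk r (x j)) = Quotient.mk r (A.op α x) :=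
  Quotient.sound (hr α _ _ fun j => Quotient.mk_out (s := r) (x j))

include hr in
theorem eval_quotientOp {X : Type u} (x : X → A.carrier) (s : V.Term X) :
    s.eval (quotientOp A r) (fun i => Quotient.mk r (x i)) = Quotient.mk r (s.eval A.op x) := by
  induction s with
  | var i => rfl
  | app α t ih =>
    simp only [Signature.Term.eval, ih]
    exact quotientOp_mk A r hr α _

/-- The quotient of an algebra by a congruence. -/
noncomputable def quotient : V.Alg where
  carrier := Quotient r
  op := quotientOp A r
  satisfies φ x := by
    have hx : x = fun i => Quotient.mk r (x i).out :=
      funext fun i => (Quotient.out_eq (x i)).symm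
    rw [hx, eval_quotientOp A r hr, eval_quotientOp A r hr, A.satisfies]

/-- The projection to the quotient. -/
noncomputable def quotientMk : A ⟶ quotient A r hr where
  toFun := Quotient.mk r
  map_op α x := (quotientOp_mk A r hr α x).symm

theorem quotientMk_surjective : Function.Surjective (quotientMk A r hr).toFun :=
  Quotient.exists_rep

/-- The homomorphism that a homomorphism constant on congruence classes induces. -/
noncomputable def quotientLift {B : V.Alg} (f : A ⟶ B)
    (hf : ∀ a b, r.r a b → f.toFun a = f.toFun b) : quotient A r hr ⟶ B where
  toFun := Quotient.lift f.toFun hf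
  map_op α x := by
    have hx : x = fun i => Quotient.mk r (x i).out :=
      funext fun i => (Quotient.out_eq (x i)).symm
    rw [hx]
    exact (congrArg (Quotient.lift f.toFun hf) (quotientOp_mk A r hr α _)).trans (f.map_op α _)

end Quotient

/-- The least congruence that identifies the values of two homomorphisms. -/
def coequalizerSetoid {A B : V.Alg} (f g : A ⟶ B) : Setoid B.carrier where
  -- `Prop` is impredicative, so the universal property itself may serve as the relation.
  r a b := ∀ (Z : V.Alg) (h : B ⟶ Z), f ≫ h = g ≫ h → h.toFun a = h.toFun b
  iseqv := ⟨fun _ _ _ _ => rfl, fun H Z h e => (H Z h e).symm,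
    fun H H' Z h e => (H Z h e).trans (H' Z h e)⟩

theorem hasColimit_parallelPair {A B : V.Alg} (f g : A ⟶ B) : HasColimit (parallelPair f g) := by
  have hr : ∀ (α : V.Op) (x y : V.arity α → B.carrier),
      (∀ j, (coequalizerSetoid f g).r (x j) (y j)) →
      (coequalizerSetoid f g).r (B.op α x) (B.op α y) := by
    intro α x y H Z h e
    rw [h.map_op, h.map_op]
    exact congrArg _ (funext fun j => H j Z h e)
  have w : f ≫ quotientMk B _ hr = g ≫ quotientMk B _ hr := hom_ext fun a =>
    Quotient.sound (s := coequalizerSetoid f g)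
      (fun _ _ e => congrFun (congrArg Hom.toFun e) a)
  refine ⟨⟨⟨Cofork.ofπ (quotientMk B _ hr) w, Cofork.IsColimit.mk _
    (fun s => quotientLift B _ hr s.π fun a b H => H _ _ s.condition)
    (fun _ => rfl) (fun s m hm => hom_ext fun a => ?_)⟩⟩⟩
  obtain ⟨b, rfl⟩ := quotientMk_surjective B _ hr a
  exact congrFun (congrArg Hom.toFun hm) b

instance : HasColimitsOfSize.{u, u} V.Alg :=
  have : HasCoequalizers V.Alg :=
    @hasCoequalizers_of_hasColimit_parallelPair _ _ fun {_ _ f g} => hasColimit_parallelPair f g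
  has_colimits_of_hasCoequalizers_and_coproducts

end Variety.Alg

/-! ### Coalgebras in a category with coproducts -/

section Coalgebra

variable {D : Variety.{u}} {𝒜 : Type w} [Category.{v} 𝒜] [HasCoproducts.{u} 𝒜]

namespace OpCoalg

/-- Postcomposition is a homomorphism for the induced operations: a coalgebra represents a functor.
-/
theorem eval_homOp_comp (R : OpCoalg D 𝒜) {A B : 𝒜} (k : A ⟶ B) {X : Type u}
    (x : X → (R.obj ⟶ A)) (s : D.Term X) :
    s.eval (R.homOp A) x ≫ k = s.eval (R.homOp B) (fun i => x i ≫ k) := by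
  induction s with
  | var i => rfl
  | app α t ih =>
    simp only [Signature.Term.eval, homOp, Category.assoc, ← ih]
    congr 1
    ext
    simp

theorem comp_eval_homOp {R S : OpCoalg D 𝒜} (f : R.obj ⟶ S.obj)
    (hf : ∀ α : D.Op, R.coop α ≫ Limits.Sigma.map (fun _ : D.arity α => f) = f ≫ S.coop α)
    {A : 𝒜} {X : Type u} (x : X → (S.obj ⟶ A)) (s : D.Term X) :
    f ≫ s.eval (S.homOp A) x = s.eval (R.homOp A) (fun i => f ≫ x i) := by
  induction s with
  | var i => rfl
  | app α t ih =>
    simp only [Signature.Term.eval, homOp, ← ih]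
    rw [← Category.assoc, ← hf, Category.assoc]
    congr 1
    ext
    simp

/-- The coprojections are the generic tuple: any `x` is their composite with `Sigma.desc x`. -/
theorem Cosatisfies.satisfies {R : OpCoalg D 𝒜} (hR : R.Cosatisfies) (A : 𝒜) :
    D.Satisfies (R.homOp A) := by
  intro φ x
  have h := congrArg (· ≫ Sigma.desc x) (hR φ)
  simpa only [eval_homOp_comp, colimit.ι_desc, Cofan.mk_ι_app] using h

/-- After composition with the monic map of copowers, both sides become the corresponding terms for
`S`, precomposed with `f`. -/
theorem Cosatisfies.of_mono {R S : OpCoalg D 𝒜} (hS : S.Cosatisfies) (f : R.obj ⟶ S.obj)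
    (hf : ∀ α : D.Op, R.coop α ≫ Limits.Sigma.map (fun _ : D.arity α => f) = f ≫ S.coop α)
    (hm : ∀ I : Type u, Mono (Limits.Sigma.map (fun _ : I => f))) : R.Cosatisfies := by
  intro φ
  have := hm (D.vars φ)
  rw [← cancel_mono (Limits.Sigma.map (fun _ : D.vars φ => f)), eval_homOp_comp, eval_homOp_comp]
  simp only [Sigma.ι_map, ← comp_eval_homOp f hf]
  rw [hS φ]

end OpCoalg

namespace Coalg

@[simp]
theorem comp_hom {R S T : Coalg D 𝒜} (f : R ⟶ S) (g : S ⟶ T) : (f ≫ g).hom = f.hom ≫ g.hom := rfl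

@[simp]
theorem id_hom (R : Coalg D 𝒜) : Hom.hom (𝟙 R) = 𝟙 R.obj := rfl

theorem hom_ext {R S : Coalg D 𝒜} {f g : R ⟶ S} (h : f.hom = g.hom) : f = g := Hom.ext h

variable (D 𝒜) in
/-- The underlying object of a coalgebra. -/
noncomputable def forget : Coalg D 𝒜 ⥤ 𝒜 where
  obj R := R.obj
  map f := f.hom

/-- The isomorphism of coalgebras with a given underlying isomorphism. -/
noncomputable def isoMk {R S : Coalg D 𝒜} (f : R ⟶ S) [IsIso f.hom] : R ≅ S where
  hom := f
  inv := ⟨inv f.hom, fun α => by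
    rw [IsIso.eq_inv_comp, ← Category.assoc, ← f.comm, Category.assoc, Sigma.map_comp_map]
    simp⟩
  hom_inv_id := hom_ext (by simp)
  inv_hom_id := hom_ext (by simp)

section Colimit

variable {J : Type*} [Category* J] (G : J ⥤ Coalg D 𝒜) [HasColimit (G ⋙ forget D 𝒜)]

/-- The colimit of the underlying objects. -/
noncomputable def colimitObj : 𝒜 := colimit (G ⋙ forget D 𝒜)

/-- The coprojections to the colimit of the underlying objects. -/
noncomputable def colimitι (j : J) : (G.obj j).obj ⟶ colimitObj G := colimit.ι (G ⋙ forget D 𝒜) j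

theorem map_colimitι {i j : J} (f : i ⟶ j) : (G.map f).hom ≫ colimitι G j = colimitι G i :=
  colimit.w (G ⋙ forget D 𝒜) f

variable {G} in
theorem colimitObj_hom_ext {A : 𝒜} {f g : colimitObj G ⟶ A}
    (h : ∀ j, colimitι G j ≫ f = colimitι G j ≫ g) : f = g :=
  colimit.hom_ext h

variable {G} in
/-- The morphism from the colimit of the underlying objects that a cocone induces. -/
noncomputable def colimitDesc {A : 𝒜} (a : ∀ j, (G.obj j).obj ⟶ A)
    (ha : ∀ (i j : J) (f : i ⟶ j), (G.map f).hom ≫ a j = a i) : colimitObj G ⟶ A :=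
  colimit.desc (G ⋙ forget D 𝒜)
    ⟨A, { app := a, naturality := fun _ _ f => (ha _ _ f).trans (Category.comp_id _).symm }⟩

theorem colimitι_desc {A : 𝒜} (a : ∀ j, (G.obj j).obj ⟶ A)
    (ha : ∀ (i j : J) (f : i ⟶ j), (G.map f).hom ≫ a j = a i) (j : J) :
    colimitι G j ≫ colimitDesc a ha = a j :=
  colimit.ι_desc (F := G ⋙ forget D 𝒜) _ j

/-- The co-operations on the colimit of the underlying objects. -/
noncomputable def colimitCoop (α : D.Op) :
    colimitObj G ⟶ ∐ (fun _ : D.arity α => colimitObj G) :=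
  colimitDesc (fun j => (G.obj j).coop α ≫ Limits.Sigma.map (fun _ : D.arity α => colimitι G j))
    (fun _ _ f => by
      rw [← Category.assoc, ← (G.map f).comm, Category.assoc, Sigma.map_comp_map]
      simp only [map_colimitι])

theorem colimitι_coop (j : J) (α : D.Op) :
    (G.obj j).coop α ≫ Limits.Sigma.map (fun _ : D.arity α => colimitι G j) =
      colimitι G j ≫ colimitCoop G α := by
  rw [colimitCoop, colimitι_desc]

theorem colimitDesc_comm {S : Coalg D 𝒜} (a : ∀ j, G.obj j ⟶ S)
    (ha : ∀ (i j : J) (f : i ⟶ j), (G.map f).hom ≫ (a j).hom = (a i).hom) (α : D.Op) :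
    colimitCoop G α ≫ Limits.Sigma.map (fun _ : D.arity α => colimitDesc (fun j => (a j).hom) ha) =
      colimitDesc (fun j => (a j).hom) ha ≫ S.coop α := by
  refine colimitObj_hom_ext fun j => ?_
  rw [← Category.assoc, ← colimitι_coop, Category.assoc, Sigma.map_comp_map, ← Category.assoc]
  simp only [colimitι_desc]
  exact (a j).comm α

/-- The colimit of a diagram of coalgebras. -/
noncomputable def colimitCoalg : Coalg D 𝒜 where
  obj := colimitObj G
  coop := colimitCoop G
  -- Precomposing with a coprojection moves the identity to `G.obj j`, where it holds for every
  -- tuple.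
  cosatisfies φ := colimitObj_hom_ext fun j => by
    have h := OpCoalg.comp_eval_homOp (R := (G.obj j).toOpCoalg) (S := ⟨colimitObj G, colimitCoop G⟩)
      (colimitι G j) (colimitι_coop G j) (X := D.vars φ)
      (Sigma.ι fun _ => colimitObj G)
    exact (h _).trans (((G.obj j).cosatisfies.satisfies _ φ _).trans (h _).symm)

/-- The cocone on the colimit of a diagram of coalgebras. -/
noncomputable def colimitCocone : Cocone G where
  pt := colimitCoalg G
  ι := { app := fun j => ⟨colimitι G j, colimitι_coop G j⟩
         naturality := fun _ _ f => hom_ext ((map_colimitι G f).trans (Category.comp_id _).symm) }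

/-- The universal property of the colimit of a diagram of coalgebras. -/
noncomputable def colimitCoconeIsColimit : IsColimit (colimitCocone G) where
  desc s := ⟨colimitDesc (fun j => (s.ι.app j).hom) (fun _ _ f => congrArg Hom.hom (s.w f)),
    colimitDesc_comm G s.ι.app fun _ _ f => congrArg Hom.hom (s.w f)⟩
  fac s j := hom_ext (colimitι_desc G _ (fun _ _ f => congrArg Hom.hom (s.w f)) j)
  uniq s m hm := hom_ext (colimitObj_hom_ext fun j => by
    have h := colimitι_desc G _ (fun _ _ f => congrArg Hom.hom (s.w f)) j
    exact (congrArg Hom.hom (hm j)).trans h.symm)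

end Colimit

instance {J : Type*} [Category* J] [HasColimitsOfShape J 𝒜] : HasColimitsOfShape J (Coalg D 𝒜) :=
  ⟨fun G => ⟨⟨_, colimitCoconeIsColimit G⟩⟩⟩

end Coalg

end Coalgebra

/-! ### Countable pure subcoalgebras -/

/-- Closure of a countable set under an operator from finite sets to countable sets. -/
theorem exists_countable_closed {R : Type u} (K : Finset R → Set R) (hK : ∀ F, (K F).Countable)
    {S : Set R} (hS : S.Countable) :
    ∃ Q : Set R, S ⊆ Q ∧ Q.Countable ∧ ∀ F : Finset R, ↑F ⊆ Q → K F ⊆ Q := by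
  let next : Set R → Set R := fun T => T ∪ ⋃ F ∈ {F : Finset R | ↑F ⊆ T}, K F
  let T : ℕ → Set R := fun n => next^[n] S
  have hsucc : ∀ n, T (n + 1) = next (T n) := fun n => Function.iterate_succ_apply' next n S
  have hcount : ∀ n, (T n).Countable := by
    intro n
    induction n with
    | zero => exact hS
    | succ n ih =>
      rw [hsucc]
      refine ih.union (Set.Countable.biUnion ?_ fun F _ => hK F)
      refine Set.MapsTo.countable_of_injOn (f := fun F : Finset R => (F : Set R))
        (t := {t : Set R | t.Finite ∧ t ⊆ T n}) (fun F hF => ⟨F.finite_toSet, hF⟩)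
        (Finset.coe_injective.injOn) (Set.countable_ofPred_finite_subset ih)
  have hmono : Monotone T := monotone_nat_of_le_succ fun n => by
    rw [hsucc]
    exact Set.subset_union_left
  refine ⟨⋃ n, T n, Set.subset_iUnion T 0, Set.countable_iUnion hcount, fun F hF => ?_⟩
  have : ∃ n, ↑F ⊆ T n := by
    choose! n hn using fun x (hx : x ∈ F) => Set.mem_iUnion.1 (hF hx)
    exact ⟨F.sup n, fun x hx => hmono (Finset.le_sup hx) (hn x hx)⟩
  obtain ⟨n, hn⟩ := this
  refine Set.Subset.trans (fun x hx => ?_) (Set.subset_iUnion T (n + 1))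
  rw [hsucc]
  exact .inr (Set.mem_biUnion (show F ∈ {F : Finset R | ↑F ⊆ T n} from hn) hx)

namespace Variety.Alg

variable {V : Variety.{u}}

/-- The subalgebra on a subset closed under the operations. -/
def subalgebra (A : V.Alg) (Q : Set A.carrier)
    (hQ : ∀ (α : V.Op) (x : V.arity α → A.carrier), (∀ j, x j ∈ Q) → A.op α x ∈ Q) : V.Alg where
  carrier := Q
  op α x := ⟨A.op α (fun j => x j), hQ α _ fun j => (x j).2⟩
  satisfies φ x := by
    have h : ∀ s : V.Term (V.vars φ), ((s.eval (fun α x =>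
        ⟨A.op α (fun j => x j), hQ α _ fun j => (x j).2⟩) x : Q) : A.carrier) =
        s.eval A.op (fun i => x i) := by
      intro s
      induction s with
      | var i => rfl
      | app α t ih => simp only [Signature.Term.eval, ih]
    exact Subtype.ext (((h _).trans (A.satisfies φ _)).trans (h _).symm)

/-- The inclusion of a subalgebra. -/
def subalgebraι (A : V.Alg) (Q : Set A.carrier)
    (hQ : ∀ (α : V.Op) (x : V.arity α → A.carrier), (∀ j, x j ∈ Q) → A.op α x ∈ Q) :
    subalgebra A Q hQ ⟶ A where
  toFun := Subtype.val
  map_op _ _ := rfl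

/-- A homomorphism is pure if it induces injective homomorphisms on copowers. -/
def IsPure {A B : V.Alg} (f : A ⟶ B) : Prop :=
  ∀ I : Type u, Function.Injective (Limits.Sigma.map (fun _ : I => f)).toFun

/-- An element of a copower involves countably many elements of the algebra only. -/
theorem exists_countable_sigmaMap_eq (hV : ∀ α : V.Op, Finite (V.arity α)) {R : V.Alg}
    {I : Type u} (y : (∐ fun _ : I => R).carrier) :
    ∃ W : Set R.carrier, W.Countable ∧ ∀ (Q : V.Alg) (f : Q ⟶ R) (ρ : R.carrier → Q.carrier),
      (∀ r ∈ W, f.toFun (ρ r) = r) → ∃ q, (Limits.Sigma.map (fun _ : I => f)).toFun q = y := by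
  obtain ⟨s, rfl⟩ := sigmaMk_surjective (fun _ : I => R) y
  obtain ⟨Z, hZ, h⟩ := s.exists_finite_support hV
  refine ⟨Sigma.snd '' Z, (hZ.image _).countable, fun Q f ρ hρ =>
    ⟨sigmaMk (fun _ : I => Q) (s.map fun p => ⟨p.1, ρ p.2⟩), ?_⟩⟩
  rw [sigmaMap_sigmaMk, Signature.Term.map_map]
  congr 1
  refine (h _ (fun p => p) fun p hp => ?_).trans s.map_id
  simp only [hρ _ (Set.mem_image_of_mem _ hp)]

/-- Purity can be tested on the copower indexed by the natural numbers. -/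
theorem isPure_of_coprodRel (hV : ∀ α : V.Op, Finite (V.arity α)) {Q R : V.Alg} (f : Q ⟶ R)
    (h : ∀ s t : V.Term (Σ _ : ULift.{u} ℕ, Q.carrier),
      CoprodRel (fun _ : ULift.{u} ℕ => R) (s.map fun p => ⟨p.1, f.toFun p.2⟩)
        (t.map fun p => ⟨p.1, f.toFun p.2⟩) → CoprodRel (fun _ : ULift.{u} ℕ => Q) s t) :
    IsPure f := by
  intro I
  -- `Function.invFun` below needs a point of `I`; an empty copower is initial, so the map has a
  -- left inverse.
  rcases isEmpty_or_nonempty I with hI | hI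
  · have e : Limits.Sigma.map (fun _ : I => f) ≫ Sigma.desc (fun i : I => isEmptyElim i) = 𝟙 _ :=
      Sigma.hom_ext _ _ fun i => isEmptyElim i
    exact Function.LeftInverse.injective fun a => congrFun (congrArg Hom.toFun e) a
  intro a b hab
  obtain ⟨s, rfl⟩ := sigmaMk_surjective (fun _ : I => Q) a
  obtain ⟨t, rfl⟩ := sigmaMk_surjective (fun _ : I => Q) b
  rw [sigmaMap_sigmaMk, sigmaMap_sigmaMk, sigmaMk_eq_iff] at hab
  rw [sigmaMk_eq_iff]
  obtain ⟨Z, hZ, hs⟩ := s.exists_finite_support hV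
  obtain ⟨Z', hZ', ht⟩ := t.exists_finite_support hV
  have hc : (Sigma.fst '' (Z ∪ Z')).Countable := ((hZ.union hZ').image _).countable
  obtain ⟨e, he⟩ : ∃ e : ℕ → I, Sigma.fst '' (Z ∪ Z') ⊆ Set.range e :=
    Set.countable_iff_exists_subset_range.1 hc
  -- The two terms use finitely many indices. These are sent to ℕ by `g` and recovered by `g'`.
  let g : I → ULift.{u} ℕ := fun i => ⟨Function.invFun e i⟩
  let g' : ULift.{u} ℕ → I := fun n => e n.down
  have hg : ∀ p ∈ Z ∪ Z', g' (g p.1) = p.1 := fun p hp =>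
    Function.invFun_eq (he (Set.mem_image_of_mem _ hp))
  have key := (h (s.map fun p => ⟨g p.1, p.2⟩) (t.map fun p => ⟨g p.1, p.2⟩) (by
    have := hab.map (B := fun _ : ULift.{u} ℕ => R) g (fun _ => 𝟙 R)
    rw [Signature.Term.map_map, Signature.Term.map_map] at this ⊢
    exact this)).map (B := fun _ : I => Q) g' (fun _ => 𝟙 Q)
  rw [Signature.Term.map_map, Signature.Term.map_map,
    hs _ (fun p => p) fun p hp => by simp [hg p (.inl hp)],
    ht _ (fun p => p) fun p hp => by simp [hg p (.inr hp)],
    Signature.Term.map_id, Signature.Term.map_id] at key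
  exact key

/-- A countable set of elements of an algebra `R` that is equipped with countably many maps to
copowers is contained in a countable pure subalgebra closed under these maps. -/
theorem exists_countable_isPure (hO : Countable V.Op) (hV : ∀ α : V.Op, Finite (V.arity α))
    {R : V.Alg} {ι : Type u} [Countable ι] {I : ι → Type u}
    (γ : ∀ a, R.carrier → (∐ fun _ : I a => R).carrier) {S : Set R.carrier} (hS : S.Countable) :
    ∃ (Q : V.Alg) (f : Q ⟶ R), Countable Q.carrier ∧ S ⊆ Set.range f.toFun ∧
      Function.Injective f.toFun ∧ IsPure f ∧
      ∀ a q, ∃ p, (Limits.Sigma.map (fun _ : I a => f)).toFun p = γ a (f.toFun q) := by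
  classical
  -- The point `r₀` is the default value of the retractions `ρ` and `σ` below.
  rcases isEmpty_or_nonempty R.carrier with hR | ⟨⟨r₀⟩⟩
  · refine ⟨R, 𝟙 R, ⟨fun _ => 0, fun r => hR.elim r⟩, fun r => isEmptyElim r, fun r => isEmptyElim r, fun I => ?_,
      fun a q => isEmptyElim (α := R.carrier) q⟩
    have e : Limits.Sigma.map (fun _ : I => 𝟙 R) = 𝟙 _ := by ext; simp
    rw [e]
    exact fun _ _ h => h
  choose W₁ hW₁ h₁ using fun (a : ι) (r : R.carrier) => exists_countable_sigmaMap_eq hV (γ a r)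
  have hrel : ∀ s t : V.Term (Σ _ : ULift.{u} ℕ, R.carrier), ∃ W : Set R.carrier, W.Countable ∧
      (CoprodRel (fun _ : ULift.{u} ℕ => R) s t →
        ∀ (Q : V.Alg) (f : Q ⟶ R) (ρ : R.carrier → Q.carrier),
          (∀ q, ρ (f.toFun q) = q) → (∀ r ∈ W, f.toFun (ρ r) = r) →
          CoprodRel (fun _ : ULift.{u} ℕ => Q) (s.map fun p => ⟨p.1, ρ p.2⟩)
            (t.map fun p => ⟨p.1, ρ p.2⟩)) := by
    intro s t
    by_cases h : CoprodRel (fun _ : ULift.{u} ℕ => R) s t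
    · obtain ⟨W, hW, hh⟩ := h.exists_countable hV
      exact ⟨W, hW, fun _ => hh⟩
    · exact ⟨∅, Set.countable_empty, fun h' => (h h').elim⟩
  choose W₂ hW₂ h₂ using hrel
  let emb : ∀ F : Finset R.carrier, V.Term (Σ _ : ULift.{u} ℕ, F) →
      V.Term (Σ _ : ULift.{u} ℕ, R.carrier) := fun F s => s.map fun p => ⟨p.1, p.2⟩
  -- Three demands on the closure: values of terms give a subalgebra, `W₁` makes the maps `γ`
  -- restrict, and `W₂` supplies the elements used in deriving relations between terms over `F`,
  -- which gives purity.
  let K : Finset R.carrier → Set R.carrier := fun F =>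
    Set.range (fun s : V.Term F => s.eval R.op fun x : F => (x : R.carrier)) ∪ (⋃ (a : ι) (x ∈ F), W₁ a x) ∪
      ⋃ (s : V.Term (Σ _ : ULift.{u} ℕ, F)) (t : V.Term (Σ _ : ULift.{u} ℕ, F)),
        W₂ (emb F s) (emb F t)
  have hK : ∀ F, (K F).Countable := by
    intro F
    have := Signature.Term.countable (X := F) hO hV
    have := Signature.Term.countable (X := Σ _ : ULift.{u} ℕ, F) hO hV
    exact ((Set.countable_range _).union (Set.countable_iUnion fun a =>
      F.countable_toSet.biUnion fun x _ => hW₁ a x)).union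
      (Set.countable_iUnion fun s => Set.countable_iUnion fun t => hW₂ _ _)
  obtain ⟨Q, hSQ, hQ, hKQ⟩ := exists_countable_closed K hK (hS.insert r₀)
  have hr₀ : r₀ ∈ Q := hSQ (Set.mem_insert _ _)
  have hop : ∀ (α : V.Op) (x : V.arity α → R.carrier), (∀ j, x j ∈ Q) → R.op α x ∈ Q := by
    intro α x hx
    have := Fintype.ofFinite (V.arity α)
    refine hKQ (Finset.univ.image x) (by simpa [Set.subset_def] using hx) (.inl (.inl
      ⟨.app α fun j => .var ⟨x j, Finset.mem_image_of_mem x (Finset.mem_univ j)⟩, rfl⟩))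
  let ρ : R.carrier → Q := fun r => if h : r ∈ Q then ⟨r, h⟩ else ⟨r₀, hr₀⟩
  have hρ : ∀ r ∈ Q, (ρ r : R.carrier) = r := fun r hr => by simp [ρ, hr]
  refine ⟨subalgebra R Q hop, subalgebraι R Q hop, hQ.to_subtype,
    fun r hr => ⟨⟨r, hSQ (Set.mem_insert_of_mem _ hr)⟩, rfl⟩, Subtype.val_injective,
    isPure_of_coprodRel hV _ fun s t hst => ?_, fun a q => ?_⟩
  · obtain ⟨Z, hZ, hs⟩ := s.exists_finite_support hV
    obtain ⟨Z', hZ', ht⟩ := t.exists_finite_support hV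
    let F : Finset R.carrier :=
      insert r₀ ((hZ.union hZ').toFinset.image fun p => (subalgebraι R Q hop).toFun p.2)
    have hFQ : ↑F ⊆ Q := by
      intro r hr
      rcases Finset.mem_insert.1 hr with rfl | hr
      · exact hr₀
      · obtain ⟨p, -, rfl⟩ := Finset.mem_image.1 hr
        exact p.2.2
    have hF : ∀ p ∈ Z ∪ Z', (subalgebraι R Q hop).toFun p.2 ∈ F := fun p hp =>
      Finset.mem_insert_of_mem (Finset.mem_image_of_mem _ (by simpa using hp))
    -- Rewrites `s` and `t` as terms over the finite set `F`, so that `K F` covers their relation.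
    let σ : Q → F := fun q => if h : (q : R.carrier) ∈ F then ⟨q, h⟩
      else ⟨r₀, Finset.mem_insert_self _ _⟩
    have hσ : ∀ p ∈ Z ∪ Z', (σ p.2 : R.carrier) = (subalgebraι R Q hop).toFun p.2 :=
      fun p hp => by
        have : (p.2 : Q).1 ∈ F := hF p hp
        simp only [σ, dif_pos this]
        rfl
    have es : emb F (s.map fun p => ⟨p.1, σ p.2⟩) =
        s.map fun p => ⟨p.1, (subalgebraι R Q hop).toFun p.2⟩ := by
      simp only [emb, Signature.Term.map_map]
      exact hs _ _ fun p hp => by simp only [hσ p (.inl hp)]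
    have et : emb F (t.map fun p => ⟨p.1, σ p.2⟩) =
        t.map fun p => ⟨p.1, (subalgebraι R Q hop).toFun p.2⟩ := by
      simp only [emb, Signature.Term.map_map]
      exact ht _ _ fun p hp => by simp only [hσ p (.inr hp)]
    have hρι : ∀ q, ρ ((subalgebraι R Q hop).toFun q) = q := fun q => Subtype.ext (hρ _ q.2)
    have key := h₂ _ _ hst (subalgebra R Q hop) (subalgebraι R Q hop) ρ hρι fun r hr =>
      hρ r (hKQ F hFQ (.inr (Set.mem_iUnion₂.2
        ⟨s.map fun p => ⟨p.1, σ p.2⟩, t.map fun p => ⟨p.1, σ p.2⟩, by rwa [es, et]⟩)))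
    simp only [Signature.Term.map_map, hρι] at key
    rwa [Signature.Term.map_id, Signature.Term.map_id] at key
  · refine h₁ a _ (subalgebra R Q hop) (subalgebraι R Q hop) ρ fun r hr => hρ r ?_
    refine hKQ {(subalgebraι R Q hop).toFun q} (fun r hr => ?_) (.inl (.inr ?_))
    · obtain rfl := Finset.mem_singleton.1 (Finset.mem_coe.1 hr)
      exact q.2
    exact Set.mem_iUnion.2 ⟨a, Set.mem_biUnion (Finset.mem_singleton_self _) hr⟩

end Variety.Alg

open Variety.Alg

/-- Downward Löwenheim–Skolem theorem for coalgebras: a countable set of elements lies in a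
countable pure subcoalgebra. -/
theorem Coalg.exists_countable_isPure {C D : Variety.{u}} (hC : Countable C.Op)
    (hD : Countable D.Op) (hfin : ∀ α : C.Op, Finite (C.arity α)) (R : Coalg D C.Alg)
    {S : Set R.Carrier} (hS : S.Countable) :
    ∃ (Q : Coalg D C.Alg) (f : Q ⟶ R), Countable Q.Carrier ∧ S ⊆ Set.range f.hom.toFun ∧
      Function.Injective f.hom.toFun ∧ IsPure f.hom := by
  obtain ⟨Q, f, hQ, hSQ, hf, hp, h⟩ := Variety.Alg.exists_countable_isPure hC hfin
    (fun α : D.Op => (R.coop α).toFun) hS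
  -- By purity the copower of `Q` embeds in that of `R`, so the co-operations of `R` restrict to
  -- homomorphisms.
  choose c hc using fun α : D.Op => exists_lift (f ≫ R.coop α)
    (Limits.Sigma.map (fun _ : D.arity α => f)) (hp _) (h α)
  exact ⟨⟨⟨Q, c⟩, R.cosatisfies.of_mono (R := ⟨Q, c⟩) f hc fun I => mono_of_injective _ (hp I)⟩,
    ⟨f, hc⟩, hQ, hSQ, hf, hp⟩

/-- A morphism of coalgebras with values in the image of a pure injective morphism factors
through it. -/
theorem Coalg.exists_lift {C D : Variety.{u}} {P Q R : Coalg D C.Alg} (g : P ⟶ R) (f : Q ⟶ R)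
    (hf : Function.Injective f.hom.toFun) (hp : IsPure f.hom)
    (h : Set.range g.hom.toFun ⊆ Set.range f.hom.toFun) : ∃ l : P ⟶ Q, l ≫ f = g := by
  obtain ⟨l, hl⟩ := Variety.Alg.exists_lift g.hom f.hom hf fun a => h (Set.mem_range_self a)
  refine ⟨⟨l, fun α => ?_⟩, Coalg.hom_ext hl⟩
  have := mono_of_injective _ (hp (D.arity α))
  rw [← cancel_mono (Limits.Sigma.map fun _ : D.arity α => f.hom), Category.assoc, Category.assoc,
    Sigma.map_comp_map, f.comm, ← Category.assoc, hl, ← g.comm]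

/-! ### The set of countable coalgebras -/

section Cardinal

theorem mk_pi_le_continuum {A : Type u} [Countable A] {f : A → Type u} (h : ∀ a, #(f a) ≤ 𝔠) :
    #(∀ a, f a) ≤ 𝔠 := by
  rw [Cardinal.mk_pi]
  refine (Cardinal.prod_le_prod _ (fun _ => 𝔠) h).trans ?_
  rw [Cardinal.prod_const, Cardinal.lift_id, Cardinal.lift_id]
  exact (Cardinal.power_le_power_left Cardinal.continuum_ne_zero
    (Cardinal.mk_le_aleph0_iff.2 ‹_›)).trans_eq Cardinal.continuum_power_aleph0

theorem mk_sigma_le_continuum {A : Type u} (hA : #A ≤ 𝔠) {f : A → Type u}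
    (h : ∀ a, #(f a) ≤ 𝔠) : #(Σ a, f a) ≤ 𝔠 := by
  rw [Cardinal.mk_sigma]
  refine (Cardinal.sum_le_sum _ (fun _ => 𝔠) h).trans ?_
  rw [Cardinal.sum_const']
  exact (mul_le_mul_left hA _).trans_eq Cardinal.continuum_mul_self

theorem mk_le_continuum_of_countable (A : Type u) [Countable A] : #A ≤ 𝔠 :=
  (Cardinal.mk_le_aleph0_iff.2 ‹_›).trans Cardinal.aleph0_le_continuum

end Cardinal

namespace Variety

namespace Alg

variable {V : Variety.{u}}

theorem mk_hom_le_continuum {A B : V.Alg} [Countable A.carrier] (hB : #B.carrier ≤ 𝔠) :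
    #(A ⟶ B) ≤ 𝔠 :=
  (Cardinal.mk_le_of_injective (f := Hom.toFun) fun _ _ h => Hom.ext h).trans
    (mk_pi_le_continuum fun _ => hB)

/-- The algebra structure on a set in bijection with an algebra. -/
def transport (A : V.Alg) {X : Type u} (e : X ≃ A.carrier) : V.Alg where
  carrier := X
  op α x := e.symm (A.op α fun j => e (x j))
  satisfies φ x := by
    have h : ∀ s : V.Term (V.vars φ), s.eval (fun α x => e.symm (A.op α fun j => e (x j))) x =
        e.symm (s.eval A.op fun i => e (x i)) := by
      intro s
      induction s with
      | var i => simp [Signature.Term.eval]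
      | app α t ih => simp [Signature.Term.eval, ih]
    rw [h, h, A.satisfies]

/-- The bijection as an isomorphism of algebras. -/
noncomputable def transportIso (A : V.Alg) {X : Type u} (e : X ≃ A.carrier) : A.transport e ≅ A :=
  isoOfEquiv ⟨e, fun _ _ => e.apply_symm_apply _⟩ e fun _ => rfl

end Alg

/-- Algebra structures on sets of natural numbers. -/
abbrev AlgCode (V : Variety.{u}) : Type u :=
  Σ Z : Set (ULift.{u} ℕ), {o : V.OpStr Z // V.Satisfies o}

/-- The algebra with a given code. -/
def AlgCode.alg {V : Variety.{u}} (k : V.AlgCode) : V.Alg := ⟨k.1, k.2.1, k.2.2⟩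

instance {V : Variety.{u}} (k : V.AlgCode) : Countable k.alg.carrier :=
  inferInstanceAs (Countable k.1)

theorem mk_algCode_le {V : Variety.{u}} (hO : Countable V.Op)
    (hV : ∀ α : V.Op, Finite (V.arity α)) : #V.AlgCode ≤ 𝔠 := by
  refine mk_sigma_le_continuum (by simp) fun Z => (Cardinal.mk_subtype_le _).trans
    (mk_pi_le_continuum fun α => ?_)
  -- With a finite arity there are only countably many argument tuples in `Z`.
  have := hV α
  exact mk_pi_le_continuum fun _ => mk_le_continuum_of_countable _

end Variety

variable (C D : Variety.{u})

/-- Coalgebra structures on sets of natural numbers. -/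
abbrev CoalgCode : Type u :=
  Σ k : C.AlgCode, {c : ∀ α : D.Op, k.alg ⟶ ∐ fun _ : D.arity α => k.alg //
    OpCoalg.Cosatisfies ⟨k.alg, c⟩}

variable {C D}

/-- The coalgebra with a given code. -/
noncomputable def CoalgCode.coalg (k : CoalgCode C D) : Coalg D C.Alg :=
  ⟨⟨k.1.alg, k.2.1⟩, k.2.2⟩

instance (k : CoalgCode C D) : Countable k.coalg.Carrier :=
  inferInstanceAs (Countable k.1.alg.carrier)

/-- The arity bound keeps copowers of a countable algebra of size at most 𝔠, so each co-operation
has at most 𝔠^ℵ₀ = 𝔠 choices. -/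
theorem mk_coalgCode_le (hC : Countable C.Op) (hD : Countable D.Op)
    (hfin : ∀ α : C.Op, Finite (C.arity α)) (hle : ∀ α : D.Op, #(D.arity α) ≤ 𝔠) :
    #(CoalgCode C D) ≤ 𝔠 :=
  mk_sigma_le_continuum (Variety.mk_algCode_le hC hfin) fun _ =>
    (Cardinal.mk_subtype_le _).trans (mk_pi_le_continuum fun α =>
      Variety.Alg.mk_hom_le_continuum (Variety.Alg.mk_sigma_le _ hC hfin
        Cardinal.aleph0_le_continuum (mk_sigma_le_continuum (hle α) fun _ =>
          mk_le_continuum_of_countable _)))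

theorem sigmaMap_hom_inv {𝒜 : Type w} [Category.{v} 𝒜] [HasCoproducts.{u} 𝒜] {A B : 𝒜}
    (e : A ≅ B) (I : Type u) :
    Limits.Sigma.map (fun _ : I => e.hom) ≫ Limits.Sigma.map (fun _ : I => e.inv) = 𝟙 _ :=
  Sigma.hom_ext _ _ fun i => by simp

/-- The coalgebra structure on an object isomorphic to the underlying object of a coalgebra. -/
noncomputable def Coalg.transport {D : Variety.{u}} {𝒜 : Type w} [Category.{v} 𝒜]
    [HasCoproducts.{u} 𝒜] (R : Coalg D 𝒜) {A : 𝒜} (e : A ≅ R.obj) : Coalg D 𝒜 where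
  obj := A
  coop α := e.hom ≫ R.coop α ≫ Limits.Sigma.map fun _ => e.inv
  cosatisfies := R.cosatisfies.of_mono (R := ⟨A, _⟩) e.hom
    (fun α => by simpa using R.coop α ≫= sigmaMap_hom_inv e.symm (D.arity α))
    fun I => mono_of_mono_fac (sigmaMap_hom_inv e I)

/-- The isomorphism of objects as an isomorphism of coalgebras. -/
noncomputable def Coalg.transportIso {D : Variety.{u}} {𝒜 : Type w} [Category.{v} 𝒜]
    [HasCoproducts.{u} 𝒜] (R : Coalg D 𝒜) {A : 𝒜} (e : A ≅ R.obj) : R.transport e ≅ R :=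
  let f : R.transport e ⟶ R := ⟨e.hom, fun α => by
    simpa [Coalg.transport] using e.hom ≫= R.coop α ≫= sigmaMap_hom_inv e.symm (D.arity α)⟩
  have : IsIso f.hom := inferInstanceAs (IsIso e.hom)
  Coalg.isoMk f

/-- Every countable coalgebra has a code. -/
theorem CoalgCode.exists_iso (Q : Coalg D C.Alg) [Countable Q.Carrier] :
    ∃ k : CoalgCode C D, Nonempty (k.coalg ≅ Q) := by
  obtain ⟨f, hf⟩ := exists_injective_nat Q.Carrier
  have hf' : Function.Injective fun q => ULift.up.{u} (f q) := fun a b h => hf (ULift.up.inj h)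
  let e := (Equiv.ofInjective _ hf').symm
  let A := Q.obj.transport e
  let R := Q.transport (Q.obj.transportIso e)
  exact ⟨⟨⟨_, A.op, A.satisfies⟩, R.coop, R.cosatisfies⟩, ⟨Q.transportIso (Q.obj.transportIso e)⟩⟩

/-! ### Limits of coalgebras -/

/-- Recognition of a terminal object as a colimit of a small dense family. -/
theorem nonempty_isTerminal_of_dense {𝒦 : Type*} [Category* 𝒦] {T : 𝒦} {J : Type*} (P : J → 𝒦)
    (ι : ∀ j, P j ⟶ T) (hT : ∀ g h : T ⟶ T, (∀ j, ι j ≫ g = ι j ≫ h) → g = h)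
    (hex : ∀ R, ∃ h : R ⟶ T, ∀ (j) (f : P j ⟶ R), f ≫ h = ι j)
    (hR : ∀ (R) (g h : R ⟶ T), (∀ (j) (f : P j ⟶ R), f ≫ g = f ≫ h) → g = h) :
    Nonempty (IsTerminal T) := by
  -- Applied to `T` itself, existence yields an endomorphism fixing every `ι j`, hence the identity.
  -- So `ι j` is the only morphism from `P j` to `T`.
  obtain ⟨h₀, hh₀⟩ := hex T
  have h₁ : h₀ = 𝟙 T := hT _ _ fun j => by rw [hh₀, Category.comp_id]
  have h₂ : ∀ (j) (f : P j ⟶ T), f = ι j := fun j f => by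
    rw [← hh₀ j f, h₁, Category.comp_id]
  choose h hh using hex
  exact ⟨IsTerminal.ofUniqueHom h fun R m => hR R m (h R) fun j f => by
    rw [hh, h₂ j (f ≫ m)]⟩

section Limit

variable {C D : Variety.{u}} {E : Type u} [SmallCategory E] (F : E ⥤ Coalg D C.Alg)

/-- Cones over a diagram with a countable coalgebra given by a code as vertex. -/
abbrev ConeCode : Type u := Σ k : CoalgCode C D, ((Functor.const E).obj k.coalg ⟶ F)

variable {F}

/-- The cone with a given code. -/
noncomputable def ConeCode.cone (j : ConeCode F) : Cone F := ⟨j.1.coalg, j.2⟩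

theorem Coalg.toFun_injective_of_iso {R S : Coalg D C.Alg} (e : R ≅ S) :
    Function.Injective e.hom.hom.toFun :=
  Function.LeftInverse.injective (g := e.inv.hom.toFun) fun a =>
    congrFun (congrArg (fun f => Variety.Alg.Hom.toFun (Coalg.Hom.hom f)) e.hom_inv_id) a

theorem Coalg.toFun_surjective_of_iso {R S : Coalg D C.Alg} (e : R ≅ S) :
    Function.Surjective e.hom.hom.toFun :=
  Function.RightInverse.surjective (g := e.inv.hom.toFun) fun a =>
    congrFun (congrArg (fun f => Variety.Alg.Hom.toFun (Coalg.Hom.hom f)) e.inv_hom_id) a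

theorem Coalg.isPure_of_iso {R S : Coalg D C.Alg} (e : R ≅ S) :
    Variety.Alg.IsPure e.hom.hom := by
  intro I
  have h : Limits.Sigma.map (fun _ : I => e.hom.hom) ≫ Limits.Sigma.map (fun _ : I => e.inv.hom) =
      𝟙 _ := sigmaMap_hom_inv ((Coalg.forget D C.Alg).mapIso e) I
  exact Function.LeftInverse.injective fun a =>
    congrFun (congrArg Variety.Alg.Hom.toFun h) a

theorem Variety.Alg.IsPure.comp {V : Variety.{u}} {A B M : V.Alg} {f : A ⟶ B} {g : B ⟶ M}
    (hf : IsPure f) (hg : IsPure g) : IsPure (f ≫ g) := by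
  intro I
  rw [← Sigma.map_comp_map]
  exact (hg I).comp (hf I)

/-! ### Gluing morphisms along countable pure subcones. -/

section LowenheimSkolem

variable (hC : Countable C.Op) (hD : Countable D.Op) (hfin : ∀ α : C.Op, Finite (C.arity α))
include hC hD hfin

/-- A countable set of elements of a coalgebra lies in a pure subcoalgebra that has a code. -/
theorem CoalgCode.exists_isPure (R : Coalg D C.Alg) {S : Set R.Carrier} (hS : S.Countable) :
    ∃ (k : CoalgCode C D) (f : k.coalg ⟶ R), S ⊆ Set.range f.hom.toFun ∧
      Function.Injective f.hom.toFun ∧ Variety.Alg.IsPure f.hom := by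
  obtain ⟨Q, f, hQ, hSQ, hf, hp⟩ := Coalg.exists_countable_isPure hC hD hfin R hS
  obtain ⟨k, ⟨e⟩⟩ := CoalgCode.exists_iso Q
  refine ⟨k, e.hom ≫ f, fun r hr => ?_, hf.comp (Coalg.toFun_injective_of_iso e),
    (Coalg.isPure_of_iso e).comp hp⟩
  obtain ⟨q, rfl⟩ := hSQ hr
  obtain ⟨p, rfl⟩ := Coalg.toFun_surjective_of_iso e q
  exact ⟨p, rfl⟩

theorem ConeCode.exists_isPure (R : Cone F) {S : Set R.pt.Carrier} (hS : S.Countable) :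
    ∃ (j : ConeCode F) (f : j.cone ⟶ R), S ⊆ Set.range f.hom.hom.toFun ∧
      Function.Injective f.hom.hom.toFun ∧ Variety.Alg.IsPure f.hom.hom := by
  obtain ⟨k, f, h⟩ := CoalgCode.exists_isPure hC hD hfin R.pt hS
  exact ⟨⟨k, (Functor.const E).map f ≫ R.π⟩, { hom := f, w := fun _ => rfl }, h⟩

/-- Homomorphisms on a coalgebra are determined by their restrictions to countable ones. -/
theorem ConeCode.hom_ext {R : Cone F} {B : C.Alg} {a b : R.pt.obj ⟶ B}
    (h : ∀ (j : ConeCode F) (f : j.cone ⟶ R), f.hom.hom ≫ a = f.hom.hom ≫ b) : a = b := by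
  refine Variety.Alg.hom_ext fun x => ?_
  obtain ⟨j, f, hx, -, -⟩ := ConeCode.exists_isPure hC hD hfin R (Set.countable_singleton x)
  obtain ⟨p, rfl⟩ := hx rfl
  exact congrFun (congrArg Variety.Alg.Hom.toFun (h j f)) p

/-- A compatible family of morphisms on the countable cones over a cone can be glued. -/
theorem ConeCode.exists_glue (R T : Cone F) (ι : ∀ j : ConeCode F, j.cone ⟶ T)
    (hι : ∀ (j k : ConeCode F) (f : j.cone ⟶ k.cone), f ≫ ι k = ι j) :
    ∃ h : R ⟶ T, ∀ (j : ConeCode F) (f : j.cone ⟶ R), f ≫ h = ι j := by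
  have compat : ∀ (j k : ConeCode F) (f : j.cone ⟶ R) (g : k.cone ⟶ R) (p : j.cone.pt.Carrier)
      (q : k.cone.pt.Carrier), f.hom.hom.toFun p = g.hom.hom.toFun q →
      (ι j).hom.hom.toFun p = (ι k).hom.hom.toFun q := by
    intro j k f g p q hpq
    have : Countable j.cone.pt.Carrier := inferInstanceAs (Countable j.1.coalg.Carrier)
    have : Countable k.cone.pt.Carrier := inferInstanceAs (Countable k.1.coalg.Carrier)
    -- A single countable pure subcone contains both images, so `f` and `g` factor through it and
    -- `hι` compares the two values.
    obtain ⟨l, m, hS, hm, hp⟩ := ConeCode.exists_isPure hC hD hfin R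
      ((Set.countable_range f.hom.hom.toFun).union (Set.countable_range g.hom.hom.toFun))
    have lift : ∀ (i : ConeCode F) (f : i.cone ⟶ R),
        Set.range f.hom.hom.toFun ⊆ Set.range m.hom.hom.toFun →
        ∃ f' : i.cone ⟶ l.cone, f' ≫ m = f := by
      intro i f hf
      obtain ⟨f', hf'⟩ := Coalg.exists_lift f.hom m.hom hm hp hf
      refine ⟨{ hom := f', w := fun e => ?_ }, ConeMorphism.ext _ _ hf'⟩
      rw [← m.w, ← Category.assoc, hf', f.w]
    obtain ⟨f', rfl⟩ := lift j f (Set.subset_union_left.trans hS)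
    obtain ⟨g', rfl⟩ := lift k g (Set.subset_union_right.trans hS)
    have e : f'.hom.hom.toFun p = g'.hom.hom.toFun q := hm hpq
    rw [← hι j l f', ← hι k l g']
    exact congrArg (ι l).hom.hom.toFun e
  have cover : ∀ x : R.pt.Carrier, ∃ (j : ConeCode F) (f : j.cone ⟶ R) (p : j.cone.pt.Carrier),
      f.hom.hom.toFun p = x := by
    intro x
    obtain ⟨j, f, hx, -, -⟩ := ConeCode.exists_isPure hC hD hfin R (Set.countable_singleton x)
    exact ⟨j, f, hx rfl⟩
  choose j f p hp using cover
  have key : ∀ (k : ConeCode F) (g : k.cone ⟶ R) (q : k.cone.pt.Carrier),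
      (ι (j (g.hom.hom.toFun q))).hom.hom.toFun (p (g.hom.hom.toFun q)) =
        (ι k).hom.hom.toFun q := fun k g q => compat _ _ _ g _ q (hp _)
  let h : R.pt.obj ⟶ T.pt.obj :=
    { toFun := fun x => (ι (j x)).hom.hom.toFun (p x)
      map_op := fun α x => by
        have := hfin α
        -- All arguments lie in one countable subcone, on which the glued map is the homomorphism `ι
        -- k`.
        obtain ⟨k, g, hx, -, -⟩ := ConeCode.exists_isPure hC hD hfin R (Set.countable_range x)
        choose q hq using fun i => hx (Set.mem_range_self i)
        obtain rfl : (fun i => g.hom.hom.toFun (q i)) = x := funext hq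
        rw [← g.hom.hom.map_op, key, (ι k).hom.hom.map_op]
        simp only [key] }
  have hh : ∀ (k : ConeCode F) (g : k.cone ⟶ R), g.hom.hom ≫ h = (ι k).hom.hom := fun k g =>
    Variety.Alg.hom_ext (key k g)
  refine ⟨{ hom := ⟨h, fun α => ?_⟩, w := fun e => ?_ }, fun k g =>
    ConeMorphism.ext _ _ (Coalg.hom_ext (hh k g))⟩
  · refine ConeCode.hom_ext hC hD hfin fun k g => ?_
    rw [← Category.assoc, ← Category.assoc, ← g.hom.comm, Category.assoc, Sigma.map_comp_map]
    simp only [hh]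
    exact (ι k).hom.comm α
  · refine Coalg.hom_ext (ConeCode.hom_ext hC hD hfin fun k g => ?_)
    rw [Coalg.comp_hom, ← Category.assoc, hh]
    exact (congrArg Coalg.Hom.hom ((ι k).w e)).trans (congrArg Coalg.Hom.hom (g.w e)).symm

variable (F) in
/-- The category of coalgebras has small limits. -/
theorem hasLimit : HasLimit F := by
  -- The full subcategory of coded cones is small, so the colimit of vertices exists; it inherits
  -- legs to `F`.
  let G : InducedCategory (Cone F) (ConeCode.cone (F := F)) ⥤ Coalg D C.Alg :=
    inducedFunctor _ ⋙ Cone.forget F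
  let T : Cone F :=
    { pt := colimit G
      π :=
        { app := fun e => colimit.desc G
            ⟨F.obj e, { app := fun j => (ConeCode.cone j).π.app e
                        naturality := fun j k f => (f.hom.w e).trans (Category.comp_id _).symm }⟩
          naturality := fun e e' a => colimit.hom_ext fun j => by
            have h : (ConeCode.cone j).π.app e' = (ConeCode.cone j).π.app e ≫ F.map a :=
              ((ConeCode.cone j).w a).symm
            simp
            exact h } }
  let ι : ∀ j : ConeCode F, j.cone ⟶ T := fun j =>
    { hom := colimit.ι G j, w := fun e => colimit.ι_desc _ _ }
  have hι : ∀ (j k : ConeCode F) (f : j.cone ⟶ k.cone), f ≫ ι k = ι j := fun j k f =>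
    ConeMorphism.ext _ _ (colimit.w G (InducedCategory.homMk f))
  obtain ⟨h⟩ := nonempty_isTerminal_of_dense ConeCode.cone ι
    (fun g h e => ConeMorphism.ext _ _ (colimit.hom_ext fun j =>
      congrArg ConeMorphism.hom (e j)))
    (fun R => ConeCode.exists_glue hC hD hfin R T ι hι)
    (fun R g h e => ConeMorphism.ext _ _ (Coalg.hom_ext (ConeCode.hom_ext hC hD hfin fun j f =>
      congrArg (fun m : j.cone ⟶ T => m.hom.hom) (e j f))))
  exact ⟨⟨⟨T, (Cone.isLimitEquivIsTerminal T).symm h⟩⟩⟩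

theorem exists_isTerminal : ∃ T : Coalg D C.Alg, Nonempty (IsTerminal T) := by
  have := hasLimit (Functor.empty.{u} (Coalg D C.Alg)) hC hD hfin
  exact ⟨_, ⟨isLimitEquivIsTerminalOfIsEmpty _ _ (limit.isLimit (Functor.empty.{u} _))⟩⟩

/-! ### Cardinality -/

/-- A coalgebra with few morphisms from countable coalgebras is small. -/
theorem Coalg.mk_carrier_le (hle : ∀ α : D.Op, #(D.arity α) ≤ 𝔠) (T : Coalg D C.Alg)
    (hT : ∀ k : CoalgCode C D, #(k.coalg ⟶ T) ≤ 𝔠) : #T.Carrier ≤ 𝔠 := by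
  refine (Cardinal.mk_le_of_surjective
    (f := fun p : Σ k : CoalgCode C D, Σ _ : k.coalg ⟶ T, k.coalg.Carrier =>
      p.2.1.hom.toFun p.2.2) fun x => ?_).trans
    (mk_sigma_le_continuum (mk_coalgCode_le hC hD hfin hle) fun k =>
      mk_sigma_le_continuum (hT k) fun _ => mk_le_continuum_of_countable _)
  obtain ⟨k, f, hx, -, -⟩ := CoalgCode.exists_isPure hC hD hfin T (Set.countable_singleton x)
  obtain ⟨p, hp⟩ := hx rfl
  exact ⟨⟨k, f, p⟩, hp⟩

theorem Coalg.mk_carrier_le_of_isTerminal (hle : ∀ α : D.Op, #(D.arity α) ≤ 𝔠)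
    {T : Coalg D C.Alg} (hT : IsTerminal T) : #T.Carrier ≤ 𝔠 :=
  T.mk_carrier_le hC hD hfin hle fun _ =>
    (Cardinal.le_one_iff_subsingleton.2 ⟨fun _ _ => hT.hom_ext _ _⟩).trans
      (Cardinal.one_le_aleph0.trans Cardinal.aleph0_le_continuum)

/-- A morphism to the limit is determined by countably many components, each one of at most 𝔠
homomorphisms. -/
theorem Coalg.mk_carrier_le_of_isLimit (hle : ∀ α : D.Op, #(D.arity α) ≤ 𝔠) [Countable E]
    (hF : ∀ e, #(F.obj e).Carrier ≤ 𝔠) {c : Cone F} (hc : IsLimit c) : #c.pt.Carrier ≤ 𝔠 := by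
  refine c.pt.mk_carrier_le hC hD hfin hle fun k => ?_
  have : Countable k.coalg.obj.carrier := inferInstanceAs (Countable k.coalg.Carrier)
  refine (Cardinal.mk_le_of_injective (f := fun (f : k.coalg ⟶ c.pt) (e : E) =>
    (f ≫ c.π.app e).hom) fun f g h => hc.hom_ext fun e => Coalg.hom_ext (congrFun h e)).trans
    (mk_pi_le_continuum fun e => Variety.Alg.mk_hom_le_continuum (hF e))

end LowenheimSkolem

end Limit

/-! ### The Cantor set as final coalgebra -/

/-- A set as an algebra without operations. -/
def setAlg (X : Type u) : setVariety.{u}.Alg := ⟨X, fun α => α.elim, fun φ => φ.elim⟩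

/-- A map as a homomorphism of algebras without operations. -/
def setHom {A B : setVariety.{u}.Alg} (f : A.carrier → B.carrier) : A ⟶ B :=
  ⟨f, fun α => α.elim⟩

theorem sigmaMap_ι_apply {V : Variety.{u}} {A B : V.Alg} (f : A ⟶ B) {I : Type u} (i : I)
    (a : A.carrier) : (Limits.Sigma.map fun _ : I => f).toFun
      ((Limits.Sigma.ι (fun _ : I => A) i).toFun a) =
      (Limits.Sigma.ι (fun _ : I => B) i).toFun (f.toFun a) :=
  congrFun (congrArg Variety.Alg.Hom.toFun (Sigma.ι_map (fun _ : I => f) i)) a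

/-- Copowers of sets are products. -/
noncomputable def setCopowerEquiv (A : setVariety.{u}.Alg) (I : Type u) :
    I × A.carrier ≃ (∐ fun _ : I => A).carrier :=
  have h : ∀ i, Limits.Sigma.ι (fun _ : I => A) i ≫
      Sigma.desc (fun i => (setHom fun a => (i, a) : A ⟶ setAlg (I × A.carrier))) =
        setHom fun a => (i, a) := fun i => by simp
  { toFun := fun p => (Limits.Sigma.ι (fun _ : I => A) p.1).toFun p.2
    invFun := (Sigma.desc (fun i => (setHom fun a => (i, a) : A ⟶ setAlg (I × A.carrier)))).toFun
    left_inv := fun p => congrFun (congrArg Variety.Alg.Hom.toFun (h p.1)) p.2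
    right_inv := fun y => by
      have e : Sigma.desc (fun i => (setHom fun a => (i, a) : A ⟶ setAlg (I × A.carrier))) ≫
          setHom (fun p : I × A.carrier => (Limits.Sigma.ι (fun _ : I => A) p.1).toFun p.2) =
          𝟙 (∐ fun _ : I => A) := Sigma.hom_ext _ _ fun i => by
        rw [← Category.assoc, h, Category.comp_id]
        rfl
      exact congrFun (congrArg Variety.Alg.Hom.toFun e) y }

/-- The Cantor set with the co-operation that splits off the first coordinate. -/
noncomputable def cantorCoalg : Coalg binVariety.{u} setVariety.{u}.Alg where
  obj := setAlg (ULift (ℕ → Bool))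
  coop _ := setHom fun a => (Limits.Sigma.ι (fun _ : ULift Bool => setAlg (ULift (ℕ → Bool)))
    ⟨a.down 0⟩).toFun ⟨fun n => a.down (n + 1)⟩
  cosatisfies φ := φ.elim

section

variable (R : Coalg binVariety.{u} setVariety.{u}.Alg)

/-- The co-operation of a binary coalgebra in sets, as a map to the product. -/
noncomputable def step (x : R.Carrier) : ULift.{u} Bool × R.Carrier :=
  (setCopowerEquiv R.obj (ULift Bool)).symm ((R.coop PUnit.unit).toFun x)

theorem coop_apply (x : R.Carrier) : (R.coop PUnit.unit).toFun x =
    (Limits.Sigma.ι (fun _ : ULift Bool => R.obj) (step R x).1).toFun (step R x).2 :=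
  ((setCopowerEquiv R.obj (ULift Bool)).apply_symm_apply _).symm

/-- The sequence of copies that the iterated co-operation passes through. -/
noncomputable def behaviour (x : R.Carrier) (n : ℕ) : Bool :=
  (step R ((fun y => (step R y).2)^[n] x)).1.down

/-- The morphism to the Cantor set. -/
noncomputable def toCantor : R ⟶ cantorCoalg where
  hom := setHom fun x => ⟨behaviour R x⟩
  -- The tail of the stream of `x` is, by definition of iteration, the stream of its next state.
  comm _ := Variety.Alg.hom_ext fun x =>
    (congrArg _ (coop_apply R x)).trans (sigmaMap_ι_apply _ _ _)

variable {R}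

/-- The square for `m` fixes the head of `m x` and makes its tail the image of the next state.
Induction on the coordinate, for all states at once, fixes the rest. -/
theorem eq_toCantor (m : R ⟶ cantorCoalg) : m = toCantor R := by
  have h : ∀ x, ((step R x).1, m.hom.toFun (step R x).2) =
      (⟨(m.hom.toFun x).down 0⟩, ⟨fun n => (m.hom.toFun x).down (n + 1)⟩) := fun x => by
    apply (setCopowerEquiv cantorCoalg.obj (ULift Bool)).injective
    refine Eq.trans ?_ (congrFun (congrArg Variety.Alg.Hom.toFun (m.comm PUnit.unit)) x)
    exact ((congrArg _ (coop_apply R x)).trans (sigmaMap_ι_apply _ _ _)).symm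
  have key : ∀ n x, (m.hom.toFun x).down n = behaviour R x n := by
    intro n
    induction n with
    | zero => exact fun x => (congrArg (fun p => p.1.down) (h x)).symm
    | succ n ih => exact fun x => (congrArg (fun p => p.2.down n) (h x)).symm.trans (ih _)
  exact Coalg.hom_ext (Variety.Alg.hom_ext fun x => ULift.ext _ _ (funext fun n => key n x))

end

/-- The Cantor set is the final binary coalgebra in sets. -/
noncomputable def cantorIsTerminal : IsTerminal cantorCoalg.{u} :=
  IsTerminal.ofUniqueHom toCantor fun _ => eq_toCantor

end UnivAlg

open UnivAlg
theorem corollaryC :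
    (∀ (C D : Variety.{u}), Countable C.Op → Countable D.Op →
      (∀ α : C.Op, Finite (C.arity α)) → (∀ α : D.Op, #(D.arity α) < 𝔠) →
        (∃ T : Coalg D C.Alg, Nonempty (IsTerminal T)) ∧
        (∀ T : Coalg D C.Alg, IsTerminal T → #T.Carrier ≤ 𝔠) ∧
        (∀ (E : Type u) [SmallCategory E] [Countable E] (F : E ⥤ Coalg D C.Alg),
          (∀ e : E, #(F.obj e).Carrier ≤ 𝔠) →
            HasLimit F ∧ ∀ c : Cone F, IsLimit c → #c.pt.Carrier ≤ 𝔠)) ∧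
    (∃ T : Coalg binVariety.{u} setVariety.{u}.Alg, Nonempty (IsTerminal T)) ∧
    (∀ T : Coalg binVariety.{u} setVariety.{u}.Alg, IsTerminal T →
      #T.Carrier = 𝔠 ∧
      ∃ e : T.Carrier ≃ (ℕ → Bool), ∀ x : T.Carrier,
        (T.coop PUnit.unit).toFun x =
          (Limits.Sigma.ι (fun _ : ULift.{u} Bool => T.obj) ⟨e x 0⟩).toFun
            (e.symm (fun n => e x (n + 1)))) := by
  refine ⟨fun C D hC hD hfin hlt => ⟨exists_isTerminal hC hD hfin, fun T hT =>
    Coalg.mk_carrier_le_of_isTerminal hC hD hfin (fun α => (hlt α).le) hT, ?_⟩,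
    ⟨cantorCoalg, ⟨cantorIsTerminal⟩⟩, fun T hT => ?_⟩
  · intro E _ _ F hF
    exact ⟨hasLimit F hC hD hfin, fun c hc =>
      Coalg.mk_carrier_le_of_isLimit hC hD hfin (fun α => (hlt α).le) hF hc⟩
  · let φ : T ≅ cantorCoalg := hT.uniqueUpToIso cantorIsTerminal
    have h₁ : ∀ x, φ.inv.hom.toFun (φ.hom.hom.toFun x) = x := fun x =>
      congrFun (congrArg (fun f => Variety.Alg.Hom.toFun (Coalg.Hom.hom f)) φ.hom_inv_id) x
    have h₂ : ∀ x, φ.hom.hom.toFun (φ.inv.hom.toFun x) = x := fun x =>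
      congrFun (congrArg (fun f => Variety.Alg.Hom.toFun (Coalg.Hom.hom f)) φ.inv_hom_id) x
    let e₀ : T.Carrier ≃ ULift.{u} (ℕ → Bool) := ⟨φ.hom.hom.toFun, φ.inv.hom.toFun, h₁, h₂⟩
    refine ⟨(Cardinal.mk_congr e₀).trans (by simp), e₀.trans Equiv.ulift, fun x => ?_⟩
    -- The square of the inverse isomorphism, taken at the stream of `x`, carries the shift formula
    -- back to `T`.
    have h := congrFun (congrArg Variety.Alg.Hom.toFun (φ.inv.comm PUnit.unit)) (φ.hom.hom.toFun x)
    refine Eq.trans ?_ (h.symm.trans (sigmaMap_ι_apply φ.inv.hom _ _))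
    exact congrArg (T.coop PUnit.unit).toFun (h₁ x).symm
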